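/- For $N\in\mathbb N$ let $C(S^{N-1}_{\mathbb R,*})$ be the universal unital $C^*$-algebra generated by elements $x_1,\ldots,x_N$ subject to the relations $x_i=x_i^*$, $\sum_ix_i^2=1$ and $x_ix_jx_k=x_kx_jx_i$ for all $i,j,k$. Let $S^{N-1}_{\mathbb C}=\{z\in\mathbb C^N\mid\sum_i|z_i|^2=1\}$, with coordinate functions $z_1,\ldots,z_N\in C(S^{N-1}_{\mathbb C})$. Let $f\mapsto\widetilde f$, $\widetilde f(z)=f(\bar z)$, be the automorphism of $C(S^{N-1}_{\mathbb C})$ induced by $z_i\mapsto\bar z_i$. Let $\mathbb Z_2=\langle\tau\rangle$ act on $C(S^{N-1}_{\mathbb C})$ through $\tau\cdot f=\widetilde f$, and let $C(S^{N-1}_{\mathbb C})\rtimes\mathbb Z_2$ be the corresponding crossed product $C^*$-algebra, in which $f\otimes g$ denotes the product of $f\in C(S^{N-1}_{\mathbb C})$ with the unitary implementing $g\in\mathbb Z_2$. Homomorphisms are unital $*$-homomorphisms. **Theorem.** There is a unique homomorphism $$\varphi:C(S^{N-1}_{\mathbb R,*})\to M_2(C(S^{N-1}_{\mathbb C})),\qquad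 x_i\mapsto\begin{pmatrix}0&z_i\\ \bar z_i&0\end{pmatrix},$$ and it is injective. Moreover, $\varphi$ factors as $\varphi=\kappa\circ\psi$, where $$\psi:C(S^{N-1}_{\mathbb R,*})\to C(S^{N-1}_{\mathbb C})\rtimes\mathbb Z_2,\qquad x_i\mapsto z_i\otimes\tau,$$ $$\kappa:C(S^{N-1}_{\mathbb C})\rtimes\mathbb Z_2\to M_2(C(S^{N-1}_{\mathbb C})),\qquad f\otimes1\mapsto\begin{pmatrix}f&0\\0&\widetilde f\end{pmatrix},\quad f\otimes\tau\mapsto\begin{pmatrix}0&f\\ \widetilde f&0\end{pmatrix},$$ are injective homomorphisms. -/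

import Mathlib

open scoped ENNReal

noncomputable section

/-! ## Universal C*-algebras

All C*-algebras are unital and `*`-homomorphisms between them preserve the unit. -/

/-- A nonzero C*-algebra together with a family of elements, indexed by `ι`, that satisfies the
relations `P`. -/
structure CStarModel (ι : Type) (P : ∀ (A : Type) [CStarAlgebra A], (ι → A) → Prop) : Type 1 where
  carrier : Type
  [cstar : CStarAlgebra carrier]
  [nontrivial : Nontrivial carrier]
  gen : ι → carrier
  rel : P carrier gen

attribute [instance] CStarModel.cstar CStarModel.nontrivial

/-- The relations `P` bound the norm of each generator uniformly over all C*-algebras: the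
condition under which the universal C*-algebra of the relations exists. -/
def CStarBounded {ι : Type} (P : ∀ (A : Type) [CStarAlgebra A], (ι → A) → Prop) : Prop :=
  ∀ i, ∃ C : ℝ, ∀ (A : Type) [CStarAlgebra A] (x : ι → A), P A x → ‖x i‖ ≤ C

section Universal

variable {ι : Type} {P : ∀ (A : Type) [CStarAlgebra A], (ι → A) → Prop}

/-- The `ℓ^∞`-product of all models of the relations. -/
abbrev CStarModelProd (P : ∀ (A : Type) [CStarAlgebra A], (ι → A) → Prop) : Type 1 :=
  lp (fun m : CStarModel ι P => m.carrier) ∞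

instance : CStarAlgebra (CStarModelProd P) where

/-- The universal family in the product of all models. -/
def CStarModelProd.gen (h : CStarBounded P) (i : ι) : CStarModelProd P :=
  ⟨fun m => m.gen i, memℓp_infty <| by
    obtain ⟨C, hC⟩ := h i
    exact ⟨C, by rintro _ ⟨m, rfl⟩; exact hC _ _ m.rel⟩⟩

/-- The closed `*`-subalgebra generated by the universal family in the product of all models. -/
def CStarModelProd.generated (h : CStarBounded P) : StarSubalgebra ℂ (CStarModelProd P) :=
  (StarAlgebra.adjoin ℂ (Set.range (CStarModelProd.gen h))).topologicalClosure

/-- The universal C*-algebra `C*((x_i)_{i ∈ ι} | P)`: the closed `*`-subalgebra generated by the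
universal family in the `ℓ^∞`-product of all models. Its norm of a `*`-polynomial in the generators
is thus the supremum of the norms of that `*`-polynomial over all models. -/
def UniversalCStar (h : CStarBounded P) : Type 1 := CStarModelProd.generated h

instance (h : CStarBounded P) : CStarAlgebra (UniversalCStar h) :=
  StarSubalgebra.cstarAlgebra (CStarModelProd.generated h)
    (h_closed := StarSubalgebra.isClosed_topologicalClosure _)

/-- The generators of the universal C*-algebra. -/
def UniversalCStar.gen (h : CStarBounded P) (i : ι) : UniversalCStar h :=
  ⟨CStarModelProd.gen h i,
    StarSubalgebra.le_topologicalClosure _ (StarAlgebra.subset_adjoin ℂ _ ⟨i, rfl⟩)⟩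

/-- A `*`-homomorphism out of a universal C*-algebra is determined by its values on generators. -/
theorem UniversalCStar.hom_ext (h : CStarBounded P) {B : Type*} [CStarAlgebra B]
    {φ ψ : UniversalCStar h →⋆ₐ[ℂ] B}
    (H : ∀ i, φ (UniversalCStar.gen h i) = ψ (UniversalCStar.gen h i)) : φ = ψ := by
  have hφ : Continuous φ := AddMonoidHomClass.continuous_of_bound φ 1 fun a => by
    simpa only [one_mul] using NonUnitalStarAlgHom.norm_apply_le φ a
  have hψ : Continuous ψ := AddMonoidHomClass.continuous_of_bound ψ 1 fun a => by
    simpa only [one_mul] using NonUnitalStarAlgHom.norm_apply_le ψ a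
  refine StarAlgHom.ext_topologicalClosure (R := ℂ) (A := CStarModelProd P) (B := B) hφ hψ ?_
  refine StarAlgHom.ext_adjoin ?_
  rintro ⟨_, hx⟩ ⟨i, rfl⟩
  exact H i

/-- The `*`-homomorphism from the universal C*-algebra to a model. -/
def UniversalCStar.eval (h : CStarBounded P) (m : CStarModel ι P) :
    UniversalCStar h →⋆ₐ[ℂ] m.carrier where
  toFun a := a.1 m
  map_one' := rfl
  map_mul' _ _ := rfl
  map_zero' := rfl
  map_add' _ _ := rfl
  commutes' _ := rfl
  map_star' _ := rfl

theorem UniversalCStar.eval_gen (h : CStarBounded P) (m : CStarModel ι P) (i : ι) :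
    UniversalCStar.eval h m (UniversalCStar.gen h i) = m.gen i := rfl

/-- Two elements of a universal C*-algebra are equal if they agree in every model. -/
theorem UniversalCStar.ext (h : CStarBounded P) {a b : UniversalCStar h}
    (H : ∀ m, UniversalCStar.eval h m a = UniversalCStar.eval h m b) : a = b :=
  Subtype.ext (lp.ext (funext H))

/-- The universal property of the universal C*-algebra. -/
theorem UniversalCStar.existsUnique_lift (h : CStarBounded P) {B : Type} [CStarAlgebra B]
    {y : ι → B} (hy : P B y) :
    ∃! φ : UniversalCStar h →⋆ₐ[ℂ] B, ∀ i, φ (UniversalCStar.gen h i) = y i := by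
  suffices H : ∃ φ : UniversalCStar h →⋆ₐ[ℂ] B, ∀ i, φ (UniversalCStar.gen h i) = y i by
    obtain ⟨φ, hφ⟩ := H
    exact ⟨φ, hφ, fun ψ hψ => UniversalCStar.hom_ext h fun i => by rw [hφ, hψ]⟩
  cases subsingleton_or_nontrivial B with
  | inl _ =>
    exact ⟨{ toFun := fun _ => 0
             map_one' := Subsingleton.elim _ _
             map_mul' := fun _ _ => Subsingleton.elim _ _
             map_zero' := rfl
             map_add' := fun _ _ => Subsingleton.elim _ _
             commutes' := fun _ => Subsingleton.elim _ _
             map_star' := fun _ => Subsingleton.elim _ _ }, fun _ => Subsingleton.elim _ _⟩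
  | inr _ =>
    exact ⟨UniversalCStar.eval h ⟨B, y, hy⟩, fun _ => rfl⟩

end Universal

/-! ## The half-liberated sphere -/

/-- The defining relations of the half-liberated real sphere: `x_i = x_i^*`, `∑ x_i^2 = 1` and
`x_i x_j x_k = x_k x_j x_i`. -/
structure IsHalfLiberated {N : ℕ} {A : Type*} [CStarAlgebra A] (x : Fin N → A) : Prop where
  star_eq : ∀ i, star (x i) = x i
  sum_sq : ∑ i, x i ^ 2 = 1
  half_comm : ∀ i j k, x i * x j * x k = x k * x j * x i

/-- The relations of the half-liberated sphere, as relations on families indexed by `Fin N`. -/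
abbrev halfSphereRel (N : ℕ) (A : Type) [CStarAlgebra A] (x : Fin N → A) : Prop :=
  IsHalfLiberated x

theorem IsHalfLiberated.norm_le_one {N : ℕ} {A : Type*} [CStarAlgebra A] {x : Fin N → A}
    (hx : IsHalfLiberated x) (i : Fin N) : ‖x i‖ ≤ 1 := by
  let _ := CStarAlgebra.spectralOrder A
  let _ := CStarAlgebra.spectralOrderedRing A
  have hnn : ∀ j, 0 ≤ x j ^ 2 := fun j => by
    have := star_mul_self_nonneg (x j)
    rwa [hx.star_eq, ← sq] at this
  have h1 : x i ^ 2 ≤ 1 := hx.sum_sq ▸ Finset.single_le_sum (fun j _ => hnn j) (Finset.mem_univ i)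
  have h2 : ‖x i ^ 2‖ ≤ 1 := (CStarAlgebra.norm_le_one_iff_of_nonneg _ (hnn i)).2 h1
  have h3 : ‖x i ^ 2‖ = ‖x i‖ * ‖x i‖ := by
    rw [← CStarRing.norm_star_mul_self, hx.star_eq, sq]
  nlinarith [norm_nonneg (x i)]

theorem halfSphereRel_bounded (N : ℕ) : CStarBounded (halfSphereRel N) :=
  fun i => ⟨1, fun _ _ _ hx => hx.norm_le_one i⟩

/-- `C(S^{N-1}_{ℝ,*})`: the universal C*-algebra generated by `x_1, …, x_N` with the relations
`x_i = x_i^*`, `∑ x_i^2 = 1` and `x_i x_j x_k = x_k x_j x_i`. -/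
abbrev HalfSphere (N : ℕ) : Type 1 := UniversalCStar (halfSphereRel_bounded N)

/-- The standard coordinates `x_i` of the half-liberated sphere. -/
def HalfSphere.x {N : ℕ} (i : Fin N) : HalfSphere N :=
  UniversalCStar.gen (halfSphereRel_bounded N) i

theorem HalfSphere.isHalfLiberated (N : ℕ) : IsHalfLiberated (HalfSphere.x (N := N)) where
  star_eq i := UniversalCStar.ext _ fun m => m.rel.star_eq i
  sum_sq := UniversalCStar.ext _ fun m => by
    rw [map_sum, map_one, ← m.rel.sum_sq]
    exact Finset.sum_congr rfl fun i _ => map_pow _ _ _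
  half_comm i j k := UniversalCStar.ext _ fun m => m.rel.half_comm i j k

/-! ## Crossed products by discrete groups -/

section Crossed

variable {A G : Type} [CStarAlgebra A] [Group G]

/-- The family `x`, consisting of elements `x (inl a)` for `a : A` and `x (inr g)` for `g : G`,
is a covariant representation of the action `α` of `G` on `A` in the C*-algebra `B`: the former are
the values of a `*`-homomorphism `π : A → B`, the latter are the values of a unitary representation
`u` of `G` in `B`, and `u_g π(a) u_g^* = π(α_g(a))`. -/
def IsCovariantRep (α : G →* (A ≃⋆ₐ[ℂ] A)) (B : Type*) [CStarAlgebra B] (x : A ⊕ G → B) : Prop :=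
  ∃ (π : A →⋆ₐ[ℂ] B) (u : G →* unitary B),
    (∀ a, x (Sum.inl a) = π a) ∧ (∀ g, x (Sum.inr g) = (u g : B)) ∧
    ∀ g a, (u g : B) * π a * star (u g : B) = π (α g a)

theorem isCovariantRep_bounded (α : G →* (A ≃⋆ₐ[ℂ] A)) : CStarBounded (IsCovariantRep α) := by
  rintro (a | g)
  · refine ⟨‖a‖, fun B _ x ⟨π, u, hπ, hu, _⟩ => ?_⟩
    rw [hπ]
    exact NonUnitalStarAlgHom.norm_apply_le π a
  · refine ⟨1, fun B _ x ⟨π, u, hπ, hu, _⟩ => ?_⟩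
    rw [hu]
    cases subsingleton_or_nontrivial B with
    | inl _ => simp [Subsingleton.elim (u g : B) 0]
    | inr _ => exact (CStarRing.norm_coe_unitary (u g)).le

/-- The crossed product C*-algebra `A ⋊_α G` of a C*-algebra by an action of a discrete group:
the C*-algebra generated by a universal covariant representation. -/
abbrev CrossedProduct (α : G →* (A ≃⋆ₐ[ℂ] A)) : Type 1 :=
  UniversalCStar (isCovariantRep_bounded α)

/-- The element `a ⊗ g = π(a) u_g` of the crossed product. -/
def CrossedProduct.tmul (α : G →* (A ≃⋆ₐ[ℂ] A)) (a : A) (g : G) : CrossedProduct α :=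
  UniversalCStar.gen (isCovariantRep_bounded α) (Sum.inl a) *
    UniversalCStar.gen (isCovariantRep_bounded α) (Sum.inr g)

/-- The generators of the crossed product form a covariant representation. -/
theorem CrossedProduct.isCovariantRep_gen (α : G →* (A ≃⋆ₐ[ℂ] A)) :
    IsCovariantRep α (CrossedProduct α) (UniversalCStar.gen (isCovariantRep_bounded α)) := by
  have key : ∀ m : CStarModel (A ⊕ G) (IsCovariantRep α), ∃ (π : A →⋆ₐ[ℂ] m.carrier)
      (u : G →* unitary m.carrier), (∀ a, m.gen (Sum.inl a) = π a) ∧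
      (∀ g, m.gen (Sum.inr g) = (u g : m.carrier)) ∧
      ∀ g a, (u g : m.carrier) * π a * star (u g : m.carrier) = π (α g a) := fun m => m.rel
  choose π u hπ hu hc using key
  refine ⟨{ toFun := fun a => UniversalCStar.gen _ (Sum.inl a)
            map_one' := UniversalCStar.ext _ fun m => ?_
            map_mul' := fun a b => UniversalCStar.ext _ fun m => ?_
            map_zero' := UniversalCStar.ext _ fun m => ?_
            map_add' := fun a b => UniversalCStar.ext _ fun m => ?_
            commutes' := fun r => UniversalCStar.ext _ fun m => ?_
            map_star' := fun a => UniversalCStar.ext _ fun m => ?_ },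
          { toFun := fun g => ⟨UniversalCStar.gen _ (Sum.inr g), ?_⟩
            map_one' := Subtype.ext (UniversalCStar.ext _ fun m => ?_)
            map_mul' := fun g h => Subtype.ext (UniversalCStar.ext _ fun m => ?_) },
          fun a => rfl, fun g => rfl, fun g a => UniversalCStar.ext _ fun m => ?_⟩
  · simp [UniversalCStar.eval_gen, hπ]
  · simp [UniversalCStar.eval_gen, hπ]
  · simp [UniversalCStar.eval_gen, hπ]
  · simp [UniversalCStar.eval_gen, hπ]
  · simp [UniversalCStar.eval_gen, hπ, AlgHomClass.commutes]
  · simp [UniversalCStar.eval_gen, hπ, map_star]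
  · rw [Unitary.mem_iff]
    constructor <;> refine UniversalCStar.ext _ fun m => ?_ <;>
      simp [UniversalCStar.eval_gen, hu, map_star]
  · simp [UniversalCStar.eval_gen, hu]
  · simp [UniversalCStar.eval_gen, hu]
  · simpa [UniversalCStar.eval_gen, hπ, hu, map_star] using hc m g a

end Crossed

/-! ## Models in arbitrary universes -/

section Small

universe v

/-- A small C*-algebra has an isomorphic copy in `Type`. -/
theorem CStarAlgebra.exists_copy (A : Type v) [CStarAlgebra A] [Small.{0} A] :
    ∃ (B : Type) (_ : CStarAlgebra B), Nonempty (B ≃⋆ₐ[ℂ] A) := by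
  let e : Shrink.{0} A ≃ A := (equivShrink A).symm
  let _ : Ring (Shrink.{0} A) := e.ring
  let _ : Algebra ℂ (Shrink.{0} A) := e.algebra ℂ
  let _ : StarRing (Shrink.{0} A) := e.starRing
  let f : Shrink.{0} A ≃ₐ[ℂ] A := e.algEquiv ℂ
  let _ : NormedRing (Shrink.{0} A) := NormedRing.induced _ _ f.toRingEquiv.toRingHom e.injective
  let _ : NormedAlgebra ℂ (Shrink.{0} A) :=
    { norm_smul_le := fun c a => by
        change ‖f (c • a)‖ ≤ ‖c‖ * ‖f a‖
        rw [map_smul]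
        exact norm_smul_le _ _ }
  have hs : ∀ a, f (star a) = star (f a) := fun a => e.apply_symm_apply _
  have hiso : Isometry f := AddMonoidHomClass.isometry_of_norm f fun _ => rfl
  have : CompleteSpace (Shrink.{0} A) :=
    (hiso.isUniformInducing.completeSpace_congr f.surjective).2 inferInstance
  have : CStarRing (Shrink.{0} A) := ⟨fun {x} => by
    change ‖f x‖ * ‖f x‖ ≤ ‖f (star x * x)‖
    rw [map_mul, hs, CStarRing.norm_star_mul_self]⟩
  have : StarModule ℂ (Shrink.{0} A) := ⟨fun c x => f.injective (by
    rw [hs, map_smul, map_smul, hs, star_smul])⟩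
  exact ⟨Shrink.{0} A, {}, ⟨StarAlgEquiv.ofAlgEquiv f hs⟩⟩

theorem small_closure_of_small {X : Type v} [MetricSpace X] (s : Set X) [Small.{0} s] :
    Small.{0} (closure s) := by
  let T := {a : ℕ → s // ∃ x, Filter.Tendsto (fun n => (a n : X)) Filter.atTop (nhds x)}
  let g : T → X := fun a => a.2.choose
  have hsub : closure s ⊆ Set.range g := fun x hx => by
    obtain ⟨a, ha, hx⟩ := mem_closure_iff_seq_limit.1 hx
    let t : T := ⟨fun n => ⟨a n, ha n⟩, x, hx⟩
    exact ⟨t, tendsto_nhds_unique t.2.choose_spec hx⟩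
  have : Small.{0} (Set.range g) := small_range g
  exact small_subset hsub

/-- A family of elements, indexed by a type in `Type`, of a C*-algebra in any universe lies in the
image of an injective `*`-homomorphism from a C*-algebra in `Type`. Hence the models in `Type`
account for all models of a set of relations. -/
theorem CStarAlgebra.exists_small {ι : Type} {B : Type v} [CStarAlgebra B] (y : ι → B) :
    ∃ (C : Type) (_ : CStarAlgebra C) (j : C →⋆ₐ[ℂ] B),
      Function.Injective j ∧ ∀ i, ∃ c, j c = y i := by
  let S : StarSubalgebra ℂ B := StarAlgebra.adjoin ℂ (Set.range y)
  have hS : Small.{0} (S : Set B) := by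
    have hsub : (S : Set B) ⊆
        Set.range (FreeAlgebra.lift ℂ (Sum.elim y fun i => star (y i))) := fun b hb => by
      have h1 : b ∈ Algebra.adjoin ℂ (Set.range y ∪ star (Set.range y)) := by
        rw [← StarAlgebra.adjoin_toSubalgebra]
        exact hb
      have h2 : Set.range y ∪ star (Set.range y) =
          Set.range (Sum.elim y fun i => star (y i)) := by
        rw [Set.Sum.elim_range]
        congr 1
        ext b
        simp only [Set.mem_star, Set.mem_range]
        exact exists_congr fun i =>
          ⟨fun h => by rw [h, star_star], fun h => by rw [← h, star_star]⟩
      rw [h2, Algebra.adjoin_range_eq_range_freeAlgebra_lift] at h1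
      exact h1
    have : Small.{0} (Set.range (FreeAlgebra.lift ℂ (Sum.elim y fun i => star (y i)))) :=
      small_range _
    exact small_subset hsub
  have hT : Small.{0} S.topologicalClosure :=
    small_closure_of_small (S : Set B)
  let _ : CStarAlgebra S.topologicalClosure :=
    StarSubalgebra.cstarAlgebra _ (h_closed := StarSubalgebra.isClosed_topologicalClosure _)
  obtain ⟨C, hC, ⟨e⟩⟩ := CStarAlgebra.exists_copy S.topologicalClosure
  let k : S.topologicalClosure →⋆ₐ[ℂ] B := S.topologicalClosure.subtype
  refine ⟨C, hC, k.comp (e : C →⋆ₐ[ℂ] S.topologicalClosure),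
    fun a b hab => e.injective (Subtype.ext hab), fun i => ?_⟩
  have hi : y i ∈ S.topologicalClosure :=
    S.le_topologicalClosure (StarAlgebra.subset_adjoin ℂ _ ⟨i, rfl⟩)
  refine ⟨e.symm ⟨y i, hi⟩, ?_⟩
  change ((e (e.symm ⟨y i, hi⟩) : S.topologicalClosure) : B) = y i
  rw [e.apply_symm_apply]

/-- The universal property of `C(S^{N-1}_{ℝ,*})`. -/
theorem HalfSphere.existsUnique_lift {N : ℕ} {B : Type v} [CStarAlgebra B] {y : Fin N → B}
    (hy : IsHalfLiberated y) :
    ∃! φ : HalfSphere N →⋆ₐ[ℂ] B, ∀ i, φ (HalfSphere.x i) = y i := by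
  obtain ⟨C, _, j, hj, hy'⟩ := CStarAlgebra.exists_small y
  choose c hc using hy'
  have hP : IsHalfLiberated c :=
    ⟨fun i => hj (by rw [map_star, hc, hy.star_eq]),
     hj (by simp only [map_sum, map_pow, hc, hy.sum_sq, map_one]),
     fun i k l => hj (by simp only [map_mul, hc, hy.half_comm i k l])⟩
  obtain ⟨φ, hφ, -⟩ := UniversalCStar.existsUnique_lift (halfSphereRel_bounded N) hP
  have hφ' : ∀ i, φ (HalfSphere.x i) = c i := hφ
  refine ⟨j.comp φ, fun i => ?_, fun ψ hψ => UniversalCStar.hom_ext _ fun i => ?_⟩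
  · rw [StarAlgHom.comp_apply, hφ', hc]
  · change ψ (HalfSphere.x i) = j (φ (HalfSphere.x i))
    rw [hφ', hc, hψ]

/-- The universal property of the crossed product. -/
theorem CrossedProduct.existsUnique_lift {A G : Type} [CStarAlgebra A] [Group G]
    (α : G →* (A ≃⋆ₐ[ℂ] A)) {B : Type v} [CStarAlgebra B] {y : A ⊕ G → B}
    (hy : IsCovariantRep α B y) :
    ∃! φ : CrossedProduct α →⋆ₐ[ℂ] B,
      ∀ i, φ (UniversalCStar.gen (isCovariantRep_bounded α) i) = y i := by
  obtain ⟨C, _, j, hj, hy'⟩ := CStarAlgebra.exists_small y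
  choose c hc using hy'
  obtain ⟨π, u, hπ, hu, hcov⟩ := hy
  have hP : IsCovariantRep α C c := by
    refine ⟨{ toFun := fun a => c (Sum.inl a)
              map_one' := hj ?_
              map_mul' := fun a b => hj ?_
              map_zero' := hj ?_
              map_add' := fun a b => hj ?_
              commutes' := fun r => hj ?_
              map_star' := fun a => hj ?_ },
            { toFun := fun g => ⟨c (Sum.inr g), ?_⟩
              map_one' := Subtype.ext (hj ?_)
              map_mul' := fun g h => Subtype.ext (hj ?_) },
            fun a => rfl, fun g => rfl, fun g a => hj ?_⟩
    · simp [hc, hπ]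
    · simp [hc, hπ]
    · simp [hc, hπ]
    · simp [hc, hπ]
    · simp [hc, hπ, AlgHomClass.commutes]
    · simp [hc, hπ, map_star]
    · rw [Unitary.mem_iff]
      constructor <;> refine hj ?_ <;> simp [hc, hu, map_star]
    · simp [hc, hu]
    · simp [hc, hu]
    · simpa [hc, hπ, hu, map_star] using hcov g a
  obtain ⟨φ, hφ, -⟩ := UniversalCStar.existsUnique_lift (isCovariantRep_bounded α) hP
  refine ⟨j.comp φ, fun i => ?_, fun ψ hψ => UniversalCStar.hom_ext _ fun i => ?_⟩
  · rw [StarAlgHom.comp_apply, hφ, hc]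
  · rw [StarAlgHom.comp_apply, hφ, hc, hψ]

end Small

/-! ## The complex sphere -/

/-- The unit complex sphere `S^{N-1}_ℂ = {z ∈ ℂ^N | ∑ |z_i|^2 = 1}`. -/
abbrev ComplexSphere (N : ℕ) : Type := Metric.sphere (0 : EuclideanSpace ℂ (Fin N)) 1

/-- The standard coordinates `z_i` of the complex sphere. -/
def ComplexSphere.z {N : ℕ} (i : Fin N) : C(ComplexSphere N, ℂ) where
  toFun p := (p : EuclideanSpace ℂ (Fin N)) i
  continuous_toFun := by fun_prop

/-- Conjugation of the coordinates, `z_i ↦ conj z_i`, as a homeomorphism of the complex sphere. -/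
def ComplexSphere.conj (N : ℕ) : ComplexSphere N ≃ₜ ComplexSphere N where
  toFun p := ⟨WithLp.toLp 2 fun i => starRingEnd ℂ ((p : EuclideanSpace ℂ (Fin N)) i), by
    have h := p.2
    rw [mem_sphere_zero_iff_norm, EuclideanSpace.norm_eq] at h ⊢
    simpa using h⟩
  invFun p := ⟨WithLp.toLp 2 fun i => starRingEnd ℂ ((p : EuclideanSpace ℂ (Fin N)) i), by
    have h := p.2
    rw [mem_sphere_zero_iff_norm, EuclideanSpace.norm_eq] at h ⊢
    simpa using h⟩
  left_inv p := by ext; simp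
  right_inv p := by ext; simp
  continuous_toFun := by fun_prop
  continuous_invFun := by fun_prop

/-- The automorphism `f ↦ f̃` of `C(S^{N-1}_ℂ)` induced by the conjugation of the coordinates,
`f̃(z) = f(conj z)`. -/
def ComplexSphere.tilde (N : ℕ) : C(ComplexSphere N, ℂ) ≃⋆ₐ[ℂ] C(ComplexSphere N, ℂ) :=
  (ComplexSphere.conj N).compStarAlgEquiv' ℂ ℂ

theorem ComplexSphere.tilde_z {N : ℕ} (i : Fin N) :
    ComplexSphere.tilde N (ComplexSphere.z i) = star (ComplexSphere.z i) := rfl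

theorem ComplexSphere.tilde_tilde {N : ℕ} (f : C(ComplexSphere N, ℂ)) :
    ComplexSphere.tilde N (ComplexSphere.tilde N f) = f := by
  ext p
  exact congrArg f ((ComplexSphere.conj N).left_inv p)

/-- The group `ℤ_2`, written multiplicatively. -/
abbrev Z2 : Type := Multiplicative (ZMod 2)

/-- The generator of `ℤ_2`. -/
abbrev Z2.τ : Z2 := Multiplicative.ofAdd 1

/-- The action of `ℤ_2` on `C(S^{N-1}_ℂ)` in which the generator acts by `f ↦ f̃`. -/
def ComplexSphere.action (N : ℕ) :
    Z2 →* (C(ComplexSphere N, ℂ) ≃⋆ₐ[ℂ] C(ComplexSphere N, ℂ)) where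
  toFun g := if g = 1 then 1 else ComplexSphere.tilde N
  map_one' := if_pos rfl
  map_mul' g h := by
    have H : ∀ g : Z2, g = 1 ∨ g = Z2.τ := by decide
    have hτ : Z2.τ ≠ 1 := by decide
    have hττ : Z2.τ * Z2.τ = 1 := by decide
    have ht : (1 : C(ComplexSphere N, ℂ) ≃⋆ₐ[ℂ] C(ComplexSphere N, ℂ)) =
        ComplexSphere.tilde N * ComplexSphere.tilde N :=
      StarAlgEquiv.ext fun f => (ComplexSphere.tilde_tilde f).symm
    rcases H g with rfl | rfl <;> rcases H h with rfl | rfl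
    · simp
    · simp
    · simp
    · simp only [hττ, hτ, if_true, if_false, ht]

theorem ComplexSphere.action_τ (N : ℕ) :
    ComplexSphere.action N Z2.τ = ComplexSphere.tilde N := by
  have h : Z2.τ ≠ 1 := by decide
  simp [ComplexSphere.action, h]

/-- The crossed product `C(S^{N-1}_ℂ) ⋊ ℤ_2` by the conjugation of the coordinates. -/
abbrev SphereCrossedProduct (N : ℕ) : Type 1 := CrossedProduct (ComplexSphere.action N)

/-- The C*-algebra `M_2(C(S^{N-1}_ℂ))`. -/
abbrev SphereMatrix (N : ℕ) : Type := CStarMatrix (Fin 2) (Fin 2) C(ComplexSphere N, ℂ)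

end

/-!
The products `x_i x_j` commute with each other, and a character of the C*-algebra they generate is a
self-adjoint rank-one matrix of trace one, hence of the form `x_i x_j ↦ z_i z̄_j` for a point `z` of
the complex sphere. As `φ` maps `x_i x_j` to `diag(z_i z̄_j, z̄_i z_j)`, it is faithful on this even
part by Gelfand duality. If now `φ a = 0` and `σ` is the parity automorphism `x_i ↦ -x_i`, then `φ`
also kills `a* a + σ(a* a)`, because parity corresponds to conjugation by `diag(1, -1)`. This
element is even, so it vanishes, and positivity forces `a = 0`. Finally, `κ` has the left inverse
`M ↦ M₁₁ ⊗ 1 + M₁₂ ⊗ τ`, and `ψ` is injective because `κ ∘ ψ` is.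
-/

noncomputable section

/-! ## C*-algebras -/

theorem eq_zero_of_forall_character_eq_zero {A : Type*} [CommCStarAlgebra A] {a : A}
    (ha : ∀ χ : A →⋆ₐ[ℂ] ℂ, χ a = 0) : a = 0 := by
  refine (gelfandTransform_isometry A).injective ?_
  rw [map_zero]
  ext χ
  exact ha ⟨AlgHomClass.toAlgHom χ, map_star χ⟩

theorem exists_comp_eq_of_injective {A B C : Type*} [Semiring A] [Algebra ℂ A] [StarRing A]
    [Semiring B] [Algebra ℂ B] [StarRing B] [StarModule ℂ B] [Semiring C] [Algebra ℂ C]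
    [StarRing C] {π : C →⋆ₐ[ℂ] B} (hπ : Function.Injective π) {φ : A →⋆ₐ[ℂ] B}
    (hφ : ∀ a, φ a ∈ π.range) :
    ∃ θ : A →⋆ₐ[ℂ] C, ∀ a, π (θ a) = φ a :=
  ⟨((StarAlgEquiv.ofInjective π hπ).symm : π.range →⋆ₐ[ℂ] C).comp (φ.codRestrict π.range hφ),
    fun a => congrArg Subtype.val
      ((StarAlgEquiv.ofInjective π hπ).apply_symm_apply (φ.codRestrict π.range hφ a))⟩

section CStar

variable {A B : Type*} [CStarAlgebra A]

open scoped CStarAlgebra in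
theorem continuous_starAlgHom [CStarAlgebra B] (φ : A →⋆ₐ[ℂ] B) : Continuous φ :=
  map_continuous φ

theorem eq_zero_of_star_mul_self_add_map_eq_zero (σ : A →⋆ₐ[ℂ] A) {a : A}
    (ha : star a * a + σ (star a * a) = 0) : a = 0 := by
  let _ := CStarAlgebra.spectralOrder A
  let _ := CStarAlgebra.spectralOrderedRing A
  have hσ : 0 ≤ σ (star a * a) := by
    rw [map_mul, map_star]
    exact star_mul_self_nonneg _
  exact (CStarRing.star_mul_self_eq_zero_iff a).1
    ((add_eq_zero_iff_of_nonneg (star_mul_self_nonneg a) hσ).1 ha).1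

theorem injective_of_add_map_eq_zero [Ring B] [Algebra ℂ B] [Star B] {φ : A →⋆ₐ[ℂ] B}
    {σ : A →⋆ₐ[ℂ] A} (hσ : ∀ a, φ a = 0 → φ (σ a) = 0)
    (hφ : ∀ a, φ (a + σ a) = 0 → a + σ a = 0) : Function.Injective φ := by
  refine (injective_iff_map_eq_zero φ).2 fun a ha => ?_
  have h : φ (star a * a) = 0 := by rw [map_mul, ha, mul_zero]
  refine eq_zero_of_star_mul_self_add_map_eq_zero σ (hφ _ ?_)
  rw [map_add, h, hσ _ h, add_zero]

end CStar

/-- The C*-algebra `M_n(A)`. Its norm refers to an order on `A`, for which the canonical one is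
chosen. -/
@[reducible]
def matrixCStarAlgebra (n A : Type*) [Fintype n] [DecidableEq n] [CStarAlgebra A] :
    CStarAlgebra (CStarMatrix n n A) :=
  let _ := CStarAlgebra.spectralOrder A
  let _ := CStarAlgebra.spectralOrderedRing A
  CStarMatrix.instCStarAlgebra

theorem continuous_entry {n A B : Type*} [Fintype n] [DecidableEq n] [CStarAlgebra A]
    [CStarAlgebra B] (φ : B →⋆ₐ[ℂ] CStarMatrix n n A) (i j : n) :
    Continuous fun b => φ b i j := by
  let _ := matrixCStarAlgebra n A
  exact (continuous_apply_apply i j).comp (continuous_starAlgHom φ)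

namespace UniversalCStar

variable {ι : Type} {P : ∀ (A : Type) [CStarAlgebra A], (ι → A) → Prop} (h : CStarBounded P)

theorem dense_adjoin_gen :
    Dense (StarAlgebra.adjoin ℂ (Set.range (gen h)) : Set (UniversalCStar h)) := by
  let k : UniversalCStar h →⋆ₐ[ℂ] CStarModelProd P := (CStarModelProd.generated h).subtype
  have hk : Topology.IsInducing k := Topology.IsInducing.subtypeVal
  have hle : StarAlgebra.adjoin ℂ (Set.range (CStarModelProd.gen h)) ≤
      (StarAlgebra.adjoin ℂ (Set.range (gen h))).map k := by
    refine StarAlgebra.adjoin_le ?_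
    rintro _ ⟨i, rfl⟩
    exact ⟨gen h i, StarAlgebra.subset_adjoin ℂ _ ⟨i, rfl⟩, rfl⟩
  intro a
  rw [hk.closure_eq_preimage_closure_image]
  exact closure_mono hle a.2

theorem matrix_hom_ext {n B : Type*} [Fintype n] [DecidableEq n] [CStarAlgebra B]
    {φ ψ : UniversalCStar h →⋆ₐ[ℂ] CStarMatrix n n B} (H : ∀ i, φ (gen h i) = ψ (gen h i)) :
    φ = ψ :=
  let _ := matrixCStarAlgebra n B
  hom_ext h H

end UniversalCStar

/-! ## The even part of a half-liberated family -/

theorem ComplexSphere.exists_of_rank_one {N : ℕ} {p : Fin N → Fin N → ℂ}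
    (hstar : ∀ i j, star (p i j) = p j i) (htrace : ∑ i, p i i = 1)
    (hrank : ∀ i j k l, p i j * p k l = p i l * p k j) :
    ∃ z : ComplexSphere N, ∀ i j,
      p i j = ComplexSphere.z i z * star (ComplexSphere.z j z) := by
  obtain ⟨k, hk⟩ : ∃ k, p k k ≠ 0 := by
    by_contra! H
    simp [H] at htrace
  -- Normalising any nonzero column of the rank-one projection `p` gives `z`.
  let v : EuclideanSpace ℂ (Fin N) := WithLp.toLp 2 fun i => p i k
  have hnorm : (‖v‖ : ℂ) ^ 2 = p k k :=
    calc (‖v‖ : ℂ) ^ 2 = ∑ i, p i k * star (p i k) := by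
          rw [← Complex.ofReal_pow, EuclideanSpace.norm_sq_eq, Complex.ofReal_sum]
          exact Finset.sum_congr rfl fun i _ => by
            rw [Complex.ofReal_pow]; exact (Complex.mul_conj' _).symm
      _ = ∑ i, p k k * p i i := Finset.sum_congr rfl fun i _ => by
          rw [hstar, hrank, mul_comm]
      _ = p k k := by rw [← Finset.mul_sum, htrace, mul_one]
  have hv : v ≠ 0 := by
    intro hv
    exact hk (by rw [← hnorm, hv]; simp)
  refine ⟨⟨(‖v‖⁻¹ : ℂ) • v, mem_sphere_zero_iff_norm.2 (norm_smul_inv_norm hv)⟩, fun i j => ?_⟩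
  change p i j = (‖v‖⁻¹ : ℂ) * p i k * star ((‖v‖⁻¹ : ℂ) * p j k)
  have hv' : (‖v‖ : ℂ) ≠ 0 := by exact_mod_cast norm_ne_zero_iff.2 hv
  rw [star_mul', hstar, star_inv₀, Complex.star_def, Complex.conj_ofReal]
  field_simp
  rw [hnorm, hrank i k k j]

namespace IsHalfLiberated

variable {N : ℕ} {A : Type*} [CStarAlgebra A] {x : Fin N → A}

/-- The C*-algebra generated by the products `x_i x_j`. For the generators of `C(S^{N-1}_{ℝ,*})` it
is the fixed point algebra of the parity automorphism `x_i ↦ -x_i`. -/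
def evenPart (x : Fin N → A) : StarSubalgebra ℂ A :=
  (StarAlgebra.adjoin ℂ (Set.range fun p : Fin N × Fin N => x p.1 * x p.2)).topologicalClosure

theorem isClosed_evenPart (x : Fin N → A) : IsClosed (evenPart x : Set A) :=
  StarSubalgebra.isClosed_topologicalClosure _

instance : CStarAlgebra (evenPart x) :=
  StarSubalgebra.cstarAlgebra _ (h_closed := isClosed_evenPart x)

/-- The generator `x_i x_j` of the even part. -/
def evenGen (x : Fin N → A) (i j : Fin N) : evenPart x :=
  ⟨x i * x j, StarSubalgebra.le_topologicalClosure _ (StarAlgebra.subset_adjoin ℂ _ ⟨(i, j), rfl⟩)⟩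

theorem evenPart_hom_ext {B : Type*} [CStarAlgebra B] {φ ψ : evenPart x →⋆ₐ[ℂ] B}
    (h : ∀ i j, φ (evenGen x i j) = ψ (evenGen x i j)) : φ = ψ := by
  refine StarAlgHom.ext_topologicalClosure (continuous_starAlgHom φ) (continuous_starAlgHom ψ)
    (StarAlgHom.ext_adjoin ?_)
  rintro ⟨_, _⟩ ⟨⟨i, j⟩, rfl⟩
  exact h i j

theorem star_mul (hx : IsHalfLiberated x) (i j : Fin N) : star (x i * x j) = x j * x i := by
  rw [StarMul.star_mul, hx.star_eq, hx.star_eq]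

theorem mul_mul_swap (hx : IsHalfLiberated x) (i j k l : Fin N) :
    x i * x j * (x k * x l) = x i * x l * (x k * x j) := by
  rw [mul_assoc, ← mul_assoc (x j), hx.half_comm j k l]
  simp only [mul_assoc]

theorem mul_mul_comm (hx : IsHalfLiberated x) (i j k l : Fin N) :
    x i * x j * (x k * x l) = x k * x l * (x i * x j) := by
  rw [← mul_assoc, hx.half_comm i j k, mul_assoc, hx.mul_mul_swap]

theorem evenPart_mul_comm (hx : IsHalfLiberated x) (a b : evenPart x) : a * b = b * a := by
  have _ : IsMulCommutative
      (StarAlgebra.adjoin ℂ (Set.range fun p : Fin N × Fin N => x p.1 * x p.2)) := by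
    refine StarAlgebra.isMulCommutative_adjoin ℂ ?_ ?_
    · rintro _ ⟨⟨i, j⟩, rfl⟩ _ ⟨⟨k, l⟩, rfl⟩
      exact hx.mul_mul_comm i j k l
    · rintro _ ⟨⟨i, j⟩, rfl⟩ _ ⟨⟨k, l⟩, rfl⟩
      rw [hx.star_mul]
      exact hx.mul_mul_comm i j l k
  exact (StarSubalgebra.commRingTopologicalClosure _ mul_comm').mul_comm a b

theorem eq_zero_of_forall_evenPart_character_eq_zero (hx : IsHalfLiberated x) {a : evenPart x}
    (ha : ∀ χ : evenPart x →⋆ₐ[ℂ] ℂ, χ a = 0) : a = 0 :=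
  let _ : CommCStarAlgebra (evenPart x) :=
    { (inferInstance : CStarAlgebra (evenPart x)) with mul_comm := hx.evenPart_mul_comm }
  eq_zero_of_forall_character_eq_zero ha

theorem exists_sphere_of_character (hx : IsHalfLiberated x) (χ : evenPart x →⋆ₐ[ℂ] ℂ) :
    ∃ z : ComplexSphere N, ∀ i j,
      χ (evenGen x i j) = ComplexSphere.z i z * star (ComplexSphere.z j z) := by
  refine ComplexSphere.exists_of_rank_one (fun i j => ?_) ?_ fun i j k l => ?_
  · rw [← map_star]
    exact congrArg χ (Subtype.ext (hx.star_mul i j))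
  · rw [← map_sum, ← map_one χ]
    refine congrArg χ (Subtype.ext ?_)
    simpa [evenGen, sq] using hx.sum_sq
  · rw [← map_mul, ← map_mul]
    exact congrArg χ (Subtype.ext (hx.mul_mul_swap i j k l))

theorem injective_evenPart_hom (hx : IsHalfLiberated x)
    {θ : evenPart x →⋆ₐ[ℂ] C(ComplexSphere N, ℂ)}
    (hθ : ∀ i j, θ (evenGen x i j) = ComplexSphere.z i * star (ComplexSphere.z j)) :
    Function.Injective θ := by
  refine (injective_iff_map_eq_zero θ).2 fun a ha =>
    hx.eq_zero_of_forall_evenPart_character_eq_zero fun χ => ?_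
  obtain ⟨z, hz⟩ := hx.exists_sphere_of_character χ
  have hχ : χ = (ContinuousMap.evalStarAlgHom ℂ ℂ z).comp θ :=
    evenPart_hom_ext fun i j => by rw [hz, StarAlgHom.comp_apply, hθ]; rfl
  rw [hχ, StarAlgHom.comp_apply, ha, map_zero]

theorem injOn_evenPart {B : Type*} [CStarAlgebra B] (hx : IsHalfLiberated x)
    {π : C(ComplexSphere N, ℂ) →⋆ₐ[ℂ] B} (hπ : Function.Injective π) {φ : A →⋆ₐ[ℂ] B}
    (hφ : ∀ i j, φ (x i * x j) = π (ComplexSphere.z i * star (ComplexSphere.z j))) :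
    Set.InjOn φ (evenPart x) := by
  have hrange : evenPart x ≤ π.range.comap φ := by
    refine StarSubalgebra.topologicalClosure_minimal (StarAlgebra.adjoin_le ?_)
      ((NonUnitalStarAlgHom.isometry π hπ).isClosedEmbedding.isClosed_range.preimage
        (continuous_starAlgHom φ))
    rintro _ ⟨⟨i, j⟩, rfl⟩
    exact ⟨_, (hφ i j).symm⟩
  obtain ⟨θ, hθ⟩ := exists_comp_eq_of_injective hπ
    (φ := φ.comp (evenPart x).subtype) fun a => hrange a.2
  have hinj := hx.injective_evenPart_hom fun i j => hπ ((hθ _).trans (hφ i j))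
  intro a ha b hb hab
  refine congrArg Subtype.val (@hinj ⟨a, ha⟩ ⟨b, hb⟩ (hπ ?_))
  rw [hθ, hθ]
  exact hab

-- The induction passes from an odd word `w` to the even words `w * x j`.
theorem mem_evenPart_of_mem_closure {σ : A →⋆ₐ[ℂ] A}
    (hσ : ∀ i, σ (x i) = -x i) {w : A} (hw : w ∈ Submonoid.closure (Set.range x)) :
    (w ∈ evenPart x ∧ σ w = w) ∨ ((∀ j, w * x j ∈ evenPart x) ∧ σ w = -w) := by
  induction hw using Submonoid.closure_induction_right with
  | one => exact .inl ⟨one_mem _, map_one σ⟩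
  | mul_right w _ v hv ih =>
    obtain ⟨i, rfl⟩ := hv
    rcases ih with ⟨hw, hσw⟩ | ⟨hw, hσw⟩
    · refine .inr ⟨fun j => ?_, by rw [map_mul, hσw, hσ, mul_neg]⟩
      rw [mul_assoc]
      exact mul_mem hw (evenGen x i j).2
    · exact .inl ⟨hw i, by rw [map_mul, hσw, hσ, neg_mul_neg]⟩

theorem add_map_mem_evenPart_of_mem_adjoin (hx : IsHalfLiberated x) {σ : A →⋆ₐ[ℂ] A}
    (hσ : ∀ i, σ (x i) = -x i) {a : A} (ha : a ∈ StarAlgebra.adjoin ℂ (Set.range x)) :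
    a + σ a ∈ evenPart x := by
  have hstar : star (Set.range x) ⊆ Set.range x := by
    rintro a ⟨i, hi⟩
    exact ⟨i, by rw [← hx.star_eq, hi, star_star]⟩
  replace ha : a ∈ Submodule.span ℂ (Submonoid.closure (Set.range x) : Set A) := by
    rw [← Set.union_eq_self_of_subset_right hstar, ← StarAlgebra.adjoin_eq_span]
    exact ha
  induction ha using Submodule.span_induction with
  | mem w hw =>
    rcases mem_evenPart_of_mem_closure hσ hw with ⟨hw, hσw⟩ | ⟨-, hσw⟩
    · rw [hσw]
      exact add_mem hw hw
    · rw [hσw, add_neg_cancel]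
      exact zero_mem _
  | zero => simp
  | add a b _ _ ha hb =>
    rw [map_add, add_add_add_comm]
    exact add_mem ha hb
  | smul c a _ ha =>
    rw [map_smul, ← smul_add]
    exact SMulMemClass.smul_mem c ha

theorem add_map_mem_evenPart (hx : IsHalfLiberated x)
    (hdense : Dense (StarAlgebra.adjoin ℂ (Set.range x) : Set A)) {σ : A →⋆ₐ[ℂ] A}
    (hσ : ∀ i, σ (x i) = -x i) (a : A) : a + σ a ∈ evenPart x := by
  have hclosed : IsClosed {a | a + σ a ∈ evenPart x} :=
    (isClosed_evenPart x).preimage (continuous_id.add (continuous_starAlgHom σ))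
  exact closure_minimal (fun _ hb => hx.add_map_mem_evenPart_of_mem_adjoin hσ hb) hclosed
    (hdense a)

end IsHalfLiberated

namespace HalfSphere

variable {N : ℕ}

theorem exists_parity (N : ℕ) : ∃ σ : HalfSphere N →⋆ₐ[ℂ] HalfSphere N, ∀ i, σ (x i) = -x i :=
  have hx := HalfSphere.isHalfLiberated N
  (existsUnique_lift (y := fun i => -x i)
    ⟨fun i => by rw [star_neg, hx.star_eq], by simpa using hx.sum_sq,
      fun i j k => by simp [hx.half_comm i j k]⟩).exists

theorem injective_of_map_x_mul_x {B : Type*} [CStarAlgebra B] {φ : HalfSphere N →⋆ₐ[ℂ] B}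
    {π : C(ComplexSphere N, ℂ) →⋆ₐ[ℂ] B} (hπ : Function.Injective π)
    (hφ : ∀ i j, φ (x i * x j) = π (ComplexSphere.z i * star (ComplexSphere.z j)))
    {δ : B →⋆ₐ[ℂ] B} (hδ : ∀ i, δ (φ (x i)) = -φ (x i)) : Function.Injective φ := by
  obtain ⟨σ, hσ⟩ := exists_parity N
  have hx := isHalfLiberated N
  have heven := hx.add_map_mem_evenPart (UniversalCStar.dense_adjoin_gen _) hσ
  have hcomm : φ.comp σ = δ.comp φ := UniversalCStar.hom_ext _ fun i => by
    change φ (σ (x i)) = δ (φ (x i))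
    rw [hσ, map_neg, hδ]
  refine injective_of_add_map_eq_zero (σ := σ) (fun a ha => ?_) fun a ha => ?_
  · rw [← StarAlgHom.comp_apply, hcomm, StarAlgHom.comp_apply, ha, map_zero]
  · exact hx.injOn_evenPart hπ hφ (heven a) (zero_mem _) (ha.trans (map_zero φ).symm)

end HalfSphere

/-! ## Crossed products -/

namespace CrossedProduct

variable {A G : Type} [CStarAlgebra A] [Group G] (α : G →* (A ≃⋆ₐ[ℂ] A))

/-- The homomorphism `a ↦ a ⊗ 1` of the universal covariant representation. -/
def incl : A →⋆ₐ[ℂ] CrossedProduct α := (isCovariantRep_gen α).choose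

/-- The unitary `1 ⊗ g` of the universal covariant representation, which implements `α g`. -/
def implementer : G →* unitary (CrossedProduct α) := (isCovariantRep_gen α).choose_spec.choose

theorem gen_inl (a : A) :
    UniversalCStar.gen (isCovariantRep_bounded α) (Sum.inl a) = incl α a :=
  (isCovariantRep_gen α).choose_spec.choose_spec.1 a

theorem gen_inr (g : G) :
    UniversalCStar.gen (isCovariantRep_bounded α) (Sum.inr g) = implementer α g :=
  (isCovariantRep_gen α).choose_spec.choose_spec.2.1 g

theorem implementer_mul_incl (g : G) (a : A) :
    (implementer α g : CrossedProduct α) * incl α a = incl α (α g a) * implementer α g := by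
  have h := (isCovariantRep_gen α).choose_spec.choose_spec.2.2 g a
  change (implementer α g : CrossedProduct α) * incl α a * star (implementer α g : CrossedProduct α)
    = incl α (α g a) at h
  rw [← h, mul_assoc, Unitary.coe_star_mul_self, mul_one]

theorem tmul_eq (a : A) (g : G) : tmul α a g = incl α a * implementer α g := by
  rw [tmul, gen_inl, gen_inr]

theorem tmul_one_right (a : A) : tmul α a 1 = incl α a := by
  rw [tmul_eq, map_one, OneMemClass.coe_one, mul_one]

theorem tmul_one_left (g : G) : tmul α 1 g = implementer α g := by
  rw [tmul_eq, map_one, one_mul]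

theorem tmul_mul_tmul (a b : A) (g h : G) :
    tmul α a g * tmul α b h = tmul α (a * α g b) (g * h) := by
  simp only [tmul_eq, map_mul, Submonoid.coe_mul, mul_assoc]
  rw [← mul_assoc _ (incl α b), implementer_mul_incl, mul_assoc]

theorem star_tmul (a : A) (g : G) : star (tmul α a g) = tmul α (α g⁻¹ (star a)) g⁻¹ := by
  rw [tmul_eq, tmul_eq, star_mul, ← map_star, ← implementer_mul_incl, map_inv]
  rfl

theorem tmul_add_left (a b : A) (g : G) : tmul α (a + b) g = tmul α a g + tmul α b g := by
  simp only [tmul_eq, map_add, add_mul]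

theorem tmul_smul_left (c : ℂ) (a : A) (g : G) : tmul α (c • a) g = c • tmul α a g := by
  simp only [tmul_eq, map_smul, smul_mul_assoc]

theorem dense_span_range_tmul :
    Dense (Submodule.span ℂ (Set.range fun p : A × G => tmul α p.1 p.2) :
      Set (CrossedProduct α)) := by
  let M : Submonoid (CrossedProduct α) :=
    { carrier := Set.range fun p : A × G => tmul α p.1 p.2
      one_mem' := ⟨(1, 1), (tmul_one_right α 1).trans (map_one _)⟩
      mul_mem' := by
        rintro _ _ ⟨⟨a, g⟩, rfl⟩ ⟨⟨b, h⟩, rfl⟩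
        exact ⟨(a * α g b, g * h), (tmul_mul_tmul α a b g h).symm⟩ }
  have hgen : Set.range (UniversalCStar.gen (isCovariantRep_bounded α)) ⊆ M := by
    rintro _ ⟨a | g, rfl⟩
    · exact ⟨(a, 1), (tmul_one_right α a).trans (gen_inl α a).symm⟩
    · exact ⟨(1, g), (tmul_one_left α g).trans (gen_inr α g).symm⟩
  have hstar : star (Set.range (UniversalCStar.gen (isCovariantRep_bounded α))) ⊆ M := by
    intro a ha
    obtain ⟨⟨b, g⟩, hb⟩ := hgen ha
    exact ⟨(α g⁻¹ (star b), g⁻¹), (star_tmul α b g).symm.trans (star_eq_iff_star_eq.1 hb.symm)⟩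
  refine (UniversalCStar.dense_adjoin_gen (isCovariantRep_bounded α)).mono fun a ha => ?_
  exact Submodule.span_mono (Submonoid.closure_le.2 (Set.union_subset hgen hstar))
    ((StarAlgebra.adjoin_eq_span _).le ha)

theorem exists_lift_tmul {B : Type*} [CStarAlgebra B] {π : A →⋆ₐ[ℂ] B} {u : G →* unitary B}
    (h : ∀ g a, (u g : B) * π a * star (u g : B) = π (α g a)) :
    ∃ Φ : CrossedProduct α →⋆ₐ[ℂ] B, ∀ a g, Φ (tmul α a g) = π a * u g := by
  obtain ⟨Φ, hΦ, -⟩ := existsUnique_lift α (y := Sum.elim π fun g => (u g : B))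
    ⟨π, u, fun _ => rfl, fun _ => rfl, h⟩
  exact ⟨Φ, fun a g => by rw [tmul, map_mul, hΦ, hΦ]; rfl⟩

end CrossedProduct

/-! ## Actions of `ℤ_2` -/

namespace Z2

theorem eq_one_or_eq_τ : ∀ g : Z2, g = 1 ∨ g = τ := by decide

theorem τ_ne_one : τ ≠ 1 := by decide

theorem τ_mul_τ : τ * τ = 1 := by decide

/-- The homomorphism from `ℤ_2` that sends the generator to the involution `s`. -/
def lift {M : Type*} [Monoid M] (s : M) (hs : s * s = 1) : Z2 →* M where
  toFun g := if g = 1 then 1 else s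
  map_one' := if_pos rfl
  map_mul' g h := by
    rcases eq_one_or_eq_τ g with rfl | rfl <;> rcases eq_one_or_eq_τ h with rfl | rfl <;>
      simp [hs, τ_mul_τ]

theorem lift_τ {M : Type*} [Monoid M] (s : M) (hs : s * s = 1) : lift s hs τ = s :=
  if_neg (t := 1) τ_ne_one

end Z2

namespace CrossedProduct

section Matrix

variable (A : Type*) [Ring A] [StarRing A]

/-- The permutation matrix that implements the generator of `ℤ_2` on the image of `diagRep`. -/
def swap : unitary (CStarMatrix (Fin 2) (Fin 2) A) :=
  ⟨CStarMatrix.ofMatrix !![0, 1; 1, 0], by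
    rw [Unitary.mem_iff]
    constructor <;> ext i j : 2 <;> fin_cases i <;> fin_cases j <;>
      simp [CStarMatrix.mul_apply, CStarMatrix.star_apply]⟩

theorem swap_mul_swap : swap A * swap A = 1 := by
  ext i j : 3
  fin_cases i <;> fin_cases j <;> simp [swap, CStarMatrix.mul_apply]

/-- The unitary representation of `ℤ_2` on `M_2(A)` that is covariant with `diagRep`. -/
def swapRep : Z2 →* unitary (CStarMatrix (Fin 2) (Fin 2) A) := Z2.lift (swap A) (swap_mul_swap A)

theorem swapRep_τ : swapRep A Z2.τ = swap A := Z2.lift_τ _ _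

/-- The unitary `diag(1, -1)`. It anticommutes with the off-diagonal matrices, so that conjugation
by it implements the parity automorphism of the half-liberated sphere. -/
def signature : unitary (CStarMatrix (Fin 2) (Fin 2) A) :=
  ⟨CStarMatrix.ofMatrix !![1, 0; 0, -1], by
    rw [Unitary.mem_iff]
    constructor <;> ext i j : 2 <;> fin_cases i <;> fin_cases j <;>
      simp [CStarMatrix.mul_apply, CStarMatrix.star_apply]⟩

variable {A} [Algebra ℂ A] (α : Z2 →* (A ≃⋆ₐ[ℂ] A))

theorem apply_τ_apply_τ (a : A) : α Z2.τ (α Z2.τ a) = a := by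
  rw [← StarAlgEquiv.mul_apply, ← map_mul, Z2.τ_mul_τ, map_one, StarAlgEquiv.one_apply]

/-- The embedding `a ↦ diag(a, τ · a)` of `A` into `M_2(A)`. -/
def diagRep : A →⋆ₐ[ℂ] CStarMatrix (Fin 2) (Fin 2) A where
  toFun a := CStarMatrix.ofMatrix !![a, 0; 0, α Z2.τ a]
  map_one' := by
    ext i j : 2
    fin_cases i <;> fin_cases j <;> simp
  map_mul' a b := by
    ext i j : 2
    fin_cases i <;> fin_cases j <;> simp [CStarMatrix.mul_apply]
  map_zero' := by
    ext i j : 2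
    fin_cases i <;> fin_cases j <;> simp
  map_add' a b := by
    ext i j : 2
    fin_cases i <;> fin_cases j <;> simp
  commutes' r := by
    ext i j : 2
    fin_cases i <;> fin_cases j <;>
      simp [CStarMatrix.algebraMap_apply, AlgHomClass.commutes]
  map_star' a := by
    ext i j : 2
    fin_cases i <;> fin_cases j <;> simp [CStarMatrix.star_apply, map_star]

theorem diagRep_apply (a : A) : diagRep α a = CStarMatrix.ofMatrix !![a, 0; 0, α Z2.τ a] := rfl

theorem diagRep_injective : Function.Injective (diagRep α) :=
  fun _ _ h => congrFun (congrFun h 0) 0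

theorem diagRep_mul_swap (a : A) :
    diagRep α a * swap A = CStarMatrix.ofMatrix !![0, a; α Z2.τ a, 0] := by
  ext i j : 2
  fin_cases i <;> fin_cases j <;> simp [diagRep_apply, swap, CStarMatrix.mul_apply]

theorem swap_mul_diagRep (a : A) :
    (swap A : CStarMatrix (Fin 2) (Fin 2) A) * diagRep α a = diagRep α (α Z2.τ a) * swap A := by
  rw [diagRep_mul_swap, apply_τ_apply_τ]
  ext i j : 2
  fin_cases i <;> fin_cases j <;> simp [diagRep_apply, swap, CStarMatrix.mul_apply]

theorem swapRep_mul_diagRep_mul_star (g : Z2) (a : A) :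
    (swapRep A g : CStarMatrix (Fin 2) (Fin 2) A) * diagRep α a *
      star (swapRep A g : CStarMatrix (Fin 2) (Fin 2) A) = diagRep α (α g a) := by
  rcases Z2.eq_one_or_eq_τ g with rfl | rfl
  · simp
  · rw [swapRep_τ, swap_mul_diagRep, mul_assoc, Unitary.mul_star_self_of_mem (swap A).2, mul_one]

theorem conj_signature_offDiag (a b : A) :
    Unitary.conjStarAlgAut ℂ _ (signature A) (CStarMatrix.ofMatrix !![0, a; b, 0]) =
      -CStarMatrix.ofMatrix !![0, a; b, 0] := by
  rw [Unitary.conjStarAlgAut_apply]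
  ext i j : 2
  fin_cases i <;> fin_cases j <;>
    simp [signature, CStarMatrix.mul_apply, CStarMatrix.star_apply]

end Matrix

variable {A : Type} [CStarAlgebra A] (α : Z2 →* (A ≃⋆ₐ[ℂ] A))

theorem exists_toMatrix : ∃ κ : CrossedProduct α →⋆ₐ[ℂ] CStarMatrix (Fin 2) (Fin 2) A,
    ∀ a g, κ (tmul α a g) = diagRep α a * swapRep A g :=
  let _ := matrixCStarAlgebra (Fin 2) A
  exists_lift_tmul α (swapRep_mul_diagRep_mul_star α)

/-- The homomorphism `κ : A ⋊ ℤ_2 → M_2(A)` given by the covariant representation that consists of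
`diagRep` and `swapRep`. -/
def toMatrix : CrossedProduct α →⋆ₐ[ℂ] CStarMatrix (Fin 2) (Fin 2) A := (exists_toMatrix α).choose

theorem toMatrix_tmul_one (a : A) :
    toMatrix α (tmul α a 1) = CStarMatrix.ofMatrix !![a, 0; 0, α Z2.τ a] := by
  rw [toMatrix, (exists_toMatrix α).choose_spec, map_one, OneMemClass.coe_one, mul_one,
    diagRep_apply]

theorem toMatrix_tmul_τ (a : A) :
    toMatrix α (tmul α a Z2.τ) = CStarMatrix.ofMatrix !![0, a; α Z2.τ a, 0] := by
  rw [toMatrix, (exists_toMatrix α).choose_spec, swapRep_τ, diagRep_mul_swap]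

theorem tmul_entry_add_tmul_entry (b : CrossedProduct α) :
    tmul α (toMatrix α b 0 0) 1 + tmul α (toMatrix α b 0 1) Z2.τ = b := by
  have hcont : ∀ (g : Z2) (j : Fin 2),
      Continuous fun b => tmul α (toMatrix α b 0 j) g := fun g j => by
    simp only [tmul_eq]
    exact ((continuous_starAlgHom (incl α)).comp (continuous_entry (toMatrix α) 0 j)).mul_const _
  have hspan : ∀ b ∈ Submodule.span ℂ (Set.range fun p : A × Z2 => tmul α p.1 p.2),
      tmul α (toMatrix α b 0 0) 1 + tmul α (toMatrix α b 0 1) Z2.τ = b := fun b hb => by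
    induction hb using Submodule.span_induction with
    | mem b hb =>
      obtain ⟨⟨a, g⟩, rfl⟩ := hb
      rcases Z2.eq_one_or_eq_τ g with rfl | rfl
      · rw [toMatrix_tmul_one]
        simp [tmul_eq]
      · rw [toMatrix_tmul_τ]
        simp [tmul_eq]
    | zero => simp [tmul_eq]
    | add b c _ _ hb hc =>
      simp only [map_add, CStarMatrix.add_apply, tmul_add_left]
      rw [add_add_add_comm, hb, hc]
    | smul r b _ hb =>
      simp only [map_smul, CStarMatrix.smul_apply, tmul_smul_left]
      rw [← smul_add, hb]
  exact congrFun (Continuous.ext_on (dense_span_range_tmul α)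
    ((hcont 1 0).add (hcont Z2.τ 1)) continuous_id hspan) b

theorem toMatrix_injective : Function.Injective (toMatrix α) := fun a b hab => by
  rw [← tmul_entry_add_tmul_entry α a, hab, tmul_entry_add_tmul_entry α b]

theorem isHalfLiberated_tmul_τ {N : ℕ} {z : Fin N → A} (hz : ∀ i, α Z2.τ (z i) = star (z i))
    (hsum : ∑ i, z i * star (z i) = 1)
    (hcomm : ∀ i j k, z i * star (z j) * z k = z k * star (z j) * z i) :
    IsHalfLiberated fun i => tmul α (z i) Z2.τ where
  star_eq i := by
    have hinv : Z2.τ⁻¹ = Z2.τ := by decide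
    rw [star_tmul, hinv, map_star, hz, star_star]
  sum_sq := by
    simp only [sq, tmul_mul_tmul, hz, Z2.τ_mul_τ, tmul_one_right]
    rw [← map_sum, hsum, map_one]
  half_comm i j k := by
    simp only [tmul_mul_tmul, hz, Z2.τ_mul_τ, map_one, StarAlgEquiv.one_apply,
      hcomm i j k]

end CrossedProduct

theorem ComplexSphere.sum_z_mul_star_z (N : ℕ) :
    ∑ i : Fin N, ComplexSphere.z i * star (ComplexSphere.z i) = 1 := by
  ext p
  have hp : ∑ i, ‖(p : EuclideanSpace ℂ (Fin N)) i‖ ^ 2 = 1 := by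
    rw [← EuclideanSpace.norm_sq_eq, mem_sphere_zero_iff_norm.1 p.2, one_pow]
  simpa [z, Complex.mul_conj'] using congrArg ((↑) : ℝ → ℂ) hp

theorem ComplexSphere.isHalfLiberated_tmul (N : ℕ) :
    IsHalfLiberated fun i : Fin N => CrossedProduct.tmul (action N) (z i) Z2.τ :=
  CrossedProduct.isHalfLiberated_tmul_τ (action N) (fun i => by rw [action_τ, tilde_z])
    (sum_z_mul_star_z N) fun i j k => by ring

theorem HalfSphere.injective_of_map_x {N : ℕ} {φ : HalfSphere N →⋆ₐ[ℂ] SphereMatrix N}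
    (hφ : ∀ i, φ (x i) =
      CStarMatrix.ofMatrix !![0, ComplexSphere.z i; star (ComplexSphere.z i), 0]) :
    Function.Injective φ := by
  let _ := matrixCStarAlgebra (Fin 2) C(ComplexSphere N, ℂ)
  refine injective_of_map_x_mul_x (CrossedProduct.diagRep_injective (ComplexSphere.action N))
    (fun i j => ?_) (fun i => ?_)
    (δ := Unitary.conjStarAlgAut ℂ _ (CrossedProduct.signature C(ComplexSphere N, ℂ)))
  · rw [map_mul, hφ, hφ, CrossedProduct.diagRep_apply, ComplexSphere.action_τ, map_mul, map_star,
      ComplexSphere.tilde_z, ComplexSphere.tilde_z]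
    ext i j : 2
    fin_cases i <;> fin_cases j <;> simp [CStarMatrix.mul_apply]
  · rw [hφ]
    exact CrossedProduct.conj_signature_offDiag _ _

end

theorem theorem1p14 (N : ℕ) :
    ∃ φ : HalfSphere N →⋆ₐ[ℂ] SphereMatrix N,
      (∀ i, φ (HalfSphere.x i) =
        CStarMatrix.ofMatrix !![0, ComplexSphere.z i; star (ComplexSphere.z i), 0]) ∧
      (∀ φ' : HalfSphere N →⋆ₐ[ℂ] SphereMatrix N,
        (∀ i, φ' (HalfSphere.x i) =
          CStarMatrix.ofMatrix !![0, ComplexSphere.z i; star (ComplexSphere.z i), 0]) → φ' = φ) ∧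
      Function.Injective φ ∧
      ∃ (ψ : HalfSphere N →⋆ₐ[ℂ] SphereCrossedProduct N)
        (κ : SphereCrossedProduct N →⋆ₐ[ℂ] SphereMatrix N),
        (∀ i, ψ (HalfSphere.x i) =
          CrossedProduct.tmul (ComplexSphere.action N) (ComplexSphere.z i) Z2.τ) ∧
        Function.Injective ψ ∧
        (∀ f, κ (CrossedProduct.tmul (ComplexSphere.action N) f 1) =
          CStarMatrix.ofMatrix !![f, 0; 0, ComplexSphere.tilde N f]) ∧
        (∀ f, κ (CrossedProduct.tmul (ComplexSphere.action N) f Z2.τ) =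
          CStarMatrix.ofMatrix !![0, f; ComplexSphere.tilde N f, 0]) ∧
        Function.Injective κ ∧
        φ = κ.comp ψ := by
  obtain ⟨ψ, hψ, -⟩ := HalfSphere.existsUnique_lift (ComplexSphere.isHalfLiberated_tmul N)
  let κ := CrossedProduct.toMatrix (ComplexSphere.action N)
  have hκτ : ∀ f, κ (CrossedProduct.tmul (ComplexSphere.action N) f Z2.τ) =
      CStarMatrix.ofMatrix !![0, f; ComplexSphere.tilde N f, 0] := fun f => by
    rw [CrossedProduct.toMatrix_tmul_τ, ComplexSphere.action_τ]
  have hφ : ∀ i, (κ.comp ψ) (HalfSphere.x i) =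
      CStarMatrix.ofMatrix !![0, ComplexSphere.z i; star (ComplexSphere.z i), 0] := fun i => by
    rw [StarAlgHom.comp_apply, hψ, hκτ, ComplexSphere.tilde_z]
  have hinj : Function.Injective (κ ∘ ψ) := HalfSphere.injective_of_map_x hφ
  refine ⟨κ.comp ψ, hφ, fun φ' hφ' => ?_, hinj, ψ, κ, hψ, hinj.of_comp, fun f => ?_, hκτ,
    CrossedProduct.toMatrix_injective _, rfl⟩
  · exact UniversalCStar.matrix_hom_ext _ fun i => (hφ' i).trans (hφ i).symm
  · rw [CrossedProduct.toMatrix_tmul_one, ComplexSphere.action_τ]
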